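/- Let $n\ge 1$ and let $q,x_1,\dots,x_n,r,s,t,u,v,b,z,y$ be complex numbers with $0<|q|<1$. Write $(a;q)_k=\prod_{j=0}^{k-1}(1-aq^j)$, $(a;q)_\infty=\prod_{j\ge 0}(1-aq^j)$, $(a_1,\dots,a_m;q)_k=(a_1;q)_k\cdots(a_m;q)_k$, and let $$\phi_N^{(r,s,t;u,v)}(z,y|q)=\sum_{k=0}^{N}\frac{(q;q)_N}{(q;q)_k(q;q)_{N-k}}\,\frac{(r,s,t;q)_k}{(u,v;q)_k}\,z^{N-k}y^k .$$ Suppose that none of the denominators in the identity below vanishes (that is, all $x_i\neq 0$; $x_i\ne x_j$ for $i<j$; $(qx_i/x_j;q)_k\neq0$ for all $i,j$ and all $k\ge 0$; and $(u;q)_k,(v;q)_k,(bz;q)_k\ne 0$ for all $k\ge0$), that $$|z|<|x_1\cdots x_n|\,|x_m|^{-n}\,|q|^{(n-1)/2}\qquad (m=1,\dots,n),$$ and that $|y|<1$ or the ${}_4\phi_3$ series below terminates (i.e. one of $(r;q)_m,(s;q)_m,(t;q)_m,(b;q)_m$ is $0$ for some $m$). Then the series ${}_4\phi_3$ converges absolutely,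 the multiple series below converges absolutely, and, with $|\mathbf y|=y_1+\dots+y_n$ and $e_2(y_1,\dots,y_n)=\sum_{i<j}y_iy_j$, $$\sum_{y_1,\dots,y_n\ge 0}\ \prod_{1\le i<j\le n}\frac{1-\frac{x_i}{x_j}q^{y_i-y_j}}{1-\frac{x_i}{x_j}}\ \prod_{i,j=1}^n\Bigl(q\tfrac{x_i}{x_j};q\Bigr)_{y_i}^{-1}\ \prod_{i=1}^n x_i^{\,ny_i-|\mathbf y|}\ (-1)^{(n-1)|\mathbf y|}\,q^{\,y_2+2y_3+\cdots+(n-1)y_n+(n-1)\left[\binom{y_1}{2}+\cdots+\binom{y_n}{2}\right]-e_2(y_1,\dots,y_n)}\ \phi_{|\mathbf y|}^{(r,s,t;u,v)}(z,y|q)\,(b;q)_{|\mathbf y|}$$ $$=\frac{(bz;q)_\infty}{(z;q)_\infty}\ {}_4\phi_3\!\left[{r,s,t,b\atop u,v,bz};q;y\right],\qquad {}_4\phi_3\!\left[{r,s,t,b\atop u,v,bz};q;y\right]=\sum_{k=0}^\infty\frac{(r,s,t,b;q)_k}{(u,v,bz;q)_k}\,\frac{y^k}{(q;q)_k}.$$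 -/

import Mathlib

open scoped BigOperators

/-- The finite `q`-shifted factorial `(a;q)_n = (1-a)(1-aq)⋯(1-aq^{n-1})`. -/
noncomputable def qPoch (a q : ℂ) (n : ℕ) : ℂ :=
  ∏ j ∈ Finset.range n, (1 - a * q ^ j)

/-- The infinite `q`-shifted factorial `(a;q)_∞ = ∏_{j ≥ 0} (1 - a q^j)`. -/
noncomputable def qPochInf (a q : ℂ) : ℂ :=
  ∏' j : ℕ, (1 - a * q ^ j)

/-- The `q`-binomial coefficient (used for `k ≤ n`). -/
noncomputable def qBinom (q : ℂ) (n k : ℕ) : ℂ :=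
  qPoch q q n / (qPoch q q k * qPoch q q (n - k))

/-- The `n`-th term of the basic hypergeometric series with numerator parameters `as`,
denominator parameters `bs`, base `q` and argument `w`. -/
noncomputable def basicHypTerm (as bs : List ℂ) (q w : ℂ) (n : ℕ) : ℂ :=
  ((-1) ^ n * q ^ (n.choose 2)) ^ (1 + (bs.length : ℤ) - (as.length : ℤ))
    * ((as.map fun a => qPoch a q n).prod / (bs.map fun b => qPoch b q n).prod)
    * (w ^ n / qPoch q q n)

/-- The basic hypergeometric series `_𝔯Φ_𝔰[as; bs; q, w]`. -/
noncomputable def basicHyp (as bs : List ℂ) (q w : ℂ) : ℂ :=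
  ∑' n : ℕ, basicHypTerm as bs q w n

/-- The generalized Al-Salam--Carlitz polynomial
`φ_N^{(a,b,c;d,e)}(x,y|q) = ∑_{k=0}^N [N choose k]_q (a,b,c;q)_k/(d,e;q)_k x^{N-k} y^k`. -/
noncomputable def alSalamCarlitzPhi (a b c d e q : ℂ) (N : ℕ) (x y : ℂ) : ℂ :=
  ∑ k ∈ Finset.range (N + 1),
    qBinom q N k
      * ((qPoch a q k * qPoch b q k * qPoch c q k) / (qPoch d q k * qPoch e q k))
      * x ^ (N - k) * y ^ k

/-- The second elementary symmetric function of the entries of `Y`. -/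
def esymmTwo {n : ℕ} (Y : Fin n → ℕ) : ℕ :=
  ∑ i : Fin n, ∑ j ∈ Finset.Ioi i, Y i * Y j

/-- The exponent `y₂ + 2y₃ + ⋯ + (n-1)y_n + (n-1)[C(y₁,2) + ⋯ + C(y_n,2)] - e₂(y₁,…,y_n)`
(an integer; the index `i : Fin n` starts at `0`). -/
def milneExponent {n : ℕ} (Y : Fin n → ℕ) : ℤ :=
  (∑ i : Fin n, (i : ℤ) * (Y i : ℤ))
    + ((n : ℤ) - 1) * (∑ i : Fin n, ((Y i).choose 2 : ℤ))
    - (esymmTwo Y : ℤ)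

/-- The `U(n+1)` coefficient multiplying `(b;q)_{|Y|} z^{|Y|}` in Milne's multiple `q`-binomial
series, where `|Y| = y₁ + ⋯ + y_n`. -/
noncomputable def milneCoeff {n : ℕ} (q : ℂ) (x : Fin n → ℂ) (Y : Fin n → ℕ) : ℂ :=
  (∏ i : Fin n, ∏ j ∈ Finset.Ioi i,
      (1 - x i / x j * q ^ ((Y i : ℤ) - (Y j : ℤ))) / (1 - x i / x j))
    * (∏ i : Fin n, ∏ j : Fin n, (qPoch (q * (x i / x j)) q (Y i))⁻¹)
    * (∏ i : Fin n, x i ^ ((n : ℤ) * (Y i : ℤ) - ((∑ l, Y l : ℕ) : ℤ)))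
    * (-1) ^ ((n - 1) * ∑ l, Y l)
    * q ^ milneExponent Y

theorem Finset.prod_prod_Ioi_eq_prod_erase_mul {ι M : Type*} [Fintype ι] [LinearOrder ι]
    [LocallyFiniteOrderTop ι] [LocallyFiniteOrderBot ι] [CommMonoid M] (H : ι → ι → M)
    (hH : ∀ i j, i ≠ j → H i j = H j i) (k : ι) :
    ∏ i, ∏ j ∈ Finset.Ioi i, H i j =
      (∏ j ∈ Finset.univ.erase k, H k j) *
        ∏ i ∈ Finset.univ.erase k, ∏ j ∈ (Finset.Ioi i).erase k, H i j := by
  have h1 : ∀ i ∈ Finset.univ.erase k, ∏ j ∈ Finset.Ioi i, H i j =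
      (if i < k then H k i else 1) * ∏ j ∈ (Finset.Ioi i).erase k, H i j := by
    intro i hi
    split_ifs with h
    · rw [hH k i h.ne', Finset.mul_prod_erase _ _ (Finset.mem_Ioi.2 h)]
    · rw [one_mul, Finset.erase_eq_of_notMem (by simpa using h)]
  have h2 : ∏ i ∈ Finset.univ.erase k, (if i < k then H k i else 1) =
      ∏ i ∈ Finset.Iio k, H k i := by
    rw [← Finset.prod_filter]
    refine Finset.prod_congr ?_ fun _ _ => rfl
    ext i
    simp only [Finset.mem_filter, Finset.mem_erase, Finset.mem_univ, and_true, Finset.mem_Iio]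
    exact ⟨fun h => h.2, fun h => ⟨h.ne, h⟩⟩
  have h3 : Finset.univ.erase k = Finset.Ioi k ∪ Finset.Iio k := by
    ext i
    simp only [Finset.mem_erase, Finset.mem_univ, and_true, Finset.mem_union, Finset.mem_Ioi,
      Finset.mem_Iio]
    exact ⟨fun h => (lt_or_gt_of_ne h).symm, fun h => h.elim (fun h => h.ne') fun h => h.ne⟩
  have h4 : Disjoint (Finset.Ioi k) (Finset.Iio k) := by
    rw [Finset.disjoint_left]
    intro i hi hi'
    exact absurd (Finset.mem_Ioi.1 hi) (Finset.mem_Iio.1 hi').asymm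
  rw [← Finset.mul_prod_erase _ _ (Finset.mem_univ k), Finset.prod_congr rfl h1,
    Finset.prod_mul_distrib, h2, ← mul_assoc]
  conv_rhs => rw [h3, Finset.prod_union h4, ← h3]

/-- The factor of Milne's coefficient attached to a pair of variables with ratio `w` and
exponent difference `d`. -/
noncomputable def milnePair (q w : ℂ) (d : ℤ) : ℂ :=
  (1 - w * q ^ d) / (1 - w) * w ^ d * (-1) ^ d * q ^ (d * (d - 1) / 2)

theorem Int.add_one_mul_ediv_two (d : ℤ) : (d + 1) * d / 2 = d * (d - 1) / 2 + d := by
  rw [show (d + 1) * d = d * (d - 1) + d * 2 by ring, Int.add_mul_ediv_right _ _ two_ne_zero]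

theorem milnePair_inv_neg {q w : ℂ} (hq : q ≠ 0) (hw : w ≠ 0) (hw1 : 1 - w ≠ 0) (d : ℤ) :
    milnePair q w⁻¹ (-d) = milnePair q w d := by
  have h : -d * (-d - 1) / 2 = d * (d - 1) / 2 + d := by
    rw [← Int.add_one_mul_ediv_two]
    congr 1
    ring
  have h1 : w - 1 ≠ 0 := by
    rw [← neg_sub]
    exact neg_ne_zero.2 hw1
  have hm : ((-1 : ℂ) ^ d)⁻¹ = (-1) ^ d := by
    rw [← inv_zpow, inv_neg, inv_one]
  have hqd : q ^ d ≠ 0 := zpow_ne_zero _ hq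
  have hb : (1 - w⁻¹ * (q ^ d)⁻¹) * q ^ d / (1 - w⁻¹) = (1 - w * q ^ d) / (1 - w) := by
    field_simp
    ring
  rw [milnePair, milnePair, h, zpow_add₀ hq, zpow_neg q, zpow_neg (-1 : ℂ), hm, zpow_neg, inv_zpow,
    inv_inv, ← hb]
  ring

theorem milnePair_add_one {q w : ℂ} (hq : q ≠ 0) (hw : w ≠ 0) (d : ℤ)
    (hd : 1 - w * q ^ d ≠ 0) :
    milnePair q w (d + 1) =
      milnePair q w d * (-(w * q ^ d) * (1 - q * (w * q ^ d)) / (1 - w * q ^ d)) := by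
  have h : (d + 1) * (d + 1 - 1) / 2 = d * (d - 1) / 2 + d := by
    rw [← Int.add_one_mul_ediv_two, add_sub_cancel_right]
  rw [milnePair, milnePair, h, zpow_add_one₀ hq, zpow_add₀ hq, zpow_add_one₀ hw,
    zpow_add_one₀ (by norm_num : (-1 : ℂ) ≠ 0)]
  field_simp

theorem Nat.cast_choose_two_int_mul_two (a : ℕ) : ((a.choose 2 : ℕ) : ℤ) * 2 = a * (a - 1) := by
  have := Nat.choose_two_right a
  have h2 := Nat.even_mul_pred_self a
  have h3 : a.choose 2 * 2 = a * (a - 1) := by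
    rw [this]; exact Nat.div_mul_cancel h2.two_dvd
  cases a with
  | zero => simp
  | succ a =>
    have := congrArg (Nat.cast : ℕ → ℤ) h3
    push_cast at this ⊢
    simpa using this

theorem int_sub_choose_two (a b : ℕ) :
    ((a : ℤ) - b) * ((a : ℤ) - b - 1) / 2 =
      (a.choose 2 : ℤ) + (b.choose 2 : ℤ) + b - (a : ℤ) * b := by
  have h1 := Nat.cast_choose_two_int_mul_two a
  have h2 := Nat.cast_choose_two_int_mul_two b
  apply Int.ediv_eq_of_eq_mul_left two_ne_zero
  linear_combination -h1 - h2

theorem sum_sum_Ioi_add {n : ℕ} (f : Fin n → ℤ) :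
    ∑ i, ∑ j ∈ Finset.Ioi i, (f i + f j) = ((n : ℤ) - 1) * ∑ i, f i := by
  rw [Finset.sum_sum_Ioi_add_eq_sum_sum_off_diag (fun _ i : Fin n => f i), Finset.mul_sum]
  refine Finset.sum_congr rfl fun i _ => ?_
  rw [Finset.sum_const, Finset.card_compl, Finset.card_singleton, Fintype.card_fin, nsmul_eq_mul,
    Nat.cast_sub (Nat.one_le_iff_ne_zero.2 fun h => by subst h; exact i.elim0), Nat.cast_one]

theorem prod_zpow_eq_zpow_sum {ι : Type*} (s : Finset ι) {a : ℂ} (ha : a ≠ 0) (f : ι → ℤ) :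
    ∏ i ∈ s, a ^ f i = a ^ ∑ i ∈ s, f i := by
  classical
  induction s using Finset.induction_on with
  | empty => simp
  | insert i s hi ih => rw [Finset.prod_insert hi, Finset.sum_insert hi, ih, zpow_add₀ ha]

theorem sum_sum_Ioi_right {n : ℕ} (f : Fin n → ℤ) :
    ∑ i, ∑ j ∈ Finset.Ioi i, f j = ∑ i : Fin n, (i : ℤ) * f i := by
  rw [Finset.sum_comm' (t' := Finset.univ) (s' := fun y => Finset.Iio y) (by simp)]
  simp

theorem milneExponent_eq_sum_sum {n : ℕ} (Y : Fin n → ℕ) :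
    milneExponent Y =
      ∑ i, ∑ j ∈ Finset.Ioi i, ((Y i : ℤ) - Y j) * ((Y i : ℤ) - Y j - 1) / 2 := by
  simp only [int_sub_choose_two, Finset.sum_sub_distrib, Finset.sum_add_distrib,
    sum_sum_Ioi_right]
  rw [milneExponent, esymmTwo, ← sum_sum_Ioi_add]
  simp only [Finset.sum_add_distrib, sum_sum_Ioi_right]
  push_cast
  ring

theorem prod_prod_Ioi_div_zpow {n : ℕ} {x : Fin n → ℂ} (hx0 : ∀ i, x i ≠ 0) (Y : Fin n → ℕ) :
    ∏ i, ∏ j ∈ Finset.Ioi i, (x i / x j) ^ ((Y i : ℤ) - Y j) =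
      ∏ i, x i ^ ((n : ℤ) * (Y i : ℤ) - ((∑ l, Y l : ℕ) : ℤ)) := by
  have := Finset.prod_prod_Ioi_mul_eq_prod_prod_off_diag
    (fun j i : Fin n => x i ^ ((Y i : ℤ) - Y j))
  have h : ∀ i j, (x i / x j) ^ ((Y i : ℤ) - Y j) =
      x i ^ ((Y i : ℤ) - Y j) * x j ^ ((Y j : ℤ) - Y i) := by
    intro i j
    rw [div_zpow, div_eq_mul_inv, ← zpow_neg, neg_sub]
  simp only [h]
  rw [this]
  refine Finset.prod_congr rfl fun i _ => ?_
  have h0 : ∏ j ∈ ({i}ᶜ : Finset (Fin n)), x i ^ ((Y i : ℤ) - Y j) =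
      ∏ j, x i ^ ((Y i : ℤ) - Y j) := by
    rw [← Finset.prod_compl_mul_prod {i}]
    simp
  rw [h0, prod_zpow_eq_zpow_sum _ (hx0 i)]
  simp

theorem milneCoeff_eq_prod_milnePair {n : ℕ} {q : ℂ} (hq : q ≠ 0) {x : Fin n → ℂ}
    (hx0 : ∀ i, x i ≠ 0) (Y : Fin n → ℕ) :
    milneCoeff q x Y =
      (∏ i, ∏ j ∈ Finset.Ioi i, milnePair q (x i / x j) ((Y i : ℤ) - Y j)) *
        ∏ i, ∏ j, (qPoch (q * (x i / x j)) q (Y i))⁻¹ := by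
  have h1 : ∏ i, ∏ j ∈ Finset.Ioi i, q ^ (((Y i : ℤ) - Y j) * ((Y i : ℤ) - Y j - 1) / 2) =
      q ^ milneExponent Y := by
    simp only [milneExponent_eq_sum_sum, ← prod_zpow_eq_zpow_sum _ hq]
  have h2 : ∏ i, ∏ j ∈ Finset.Ioi i, (-1 : ℂ) ^ ((Y i : ℤ) - Y j) =
      (-1) ^ ((n - 1) * ∑ l, Y l) := by
    have h : ∀ i j, (-1 : ℂ) ^ ((Y i : ℤ) - Y j) = (-1) ^ ((Y i : ℤ) + Y j) := by
      intro i j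
      rw [show (Y i : ℤ) + Y j = (Y i - Y j) + 2 * Y j by ring,
        zpow_add₀ (by norm_num : (-1 : ℂ) ≠ 0), zpow_mul]
      norm_num
    simp only [h, prod_zpow_eq_zpow_sum _ (by norm_num : (-1 : ℂ) ≠ 0), sum_sum_Ioi_add]
    rcases n with _ | n
    · simp
    · rw [← zpow_natCast]
      congr 1
      push_cast
      simp
  rw [milneCoeff, ← h1, ← h2, ← prod_prod_Ioi_div_zpow hx0]
  simp only [milnePair, Finset.prod_mul_distrib]
  ring

theorem qPoch_succ (a q : ℂ) (k : ℕ) : qPoch a q (k + 1) = qPoch a q k * (1 - a * q ^ k) :=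
  Finset.prod_range_succ _ _

@[simp] theorem qPoch_zero (a q : ℂ) : qPoch a q 0 = 1 := Finset.prod_range_zero _

/-- Distinct variables stay distinct after multiplication by powers of `q`. -/
theorem mul_pow_ne_mul_pow {n : ℕ} {q : ℂ} {x : Fin n → ℂ} (hq : q ≠ 0) (hx0 : ∀ i, x i ≠ 0)
    (hx : ∀ i j, i < j → 1 - x i / x j ≠ 0)
    (hxq : ∀ i j, ∀ k : ℕ, qPoch (q * (x i / x j)) q k ≠ 0) {i j : Fin n} (hij : i ≠ j)
    (a b : ℕ) : x i * q ^ a ≠ x j * q ^ b := by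
  have key : ∀ i j, i ≠ j → ∀ a c : ℕ, x i * q ^ (a + c) ≠ x j * q ^ a := by
    intro i j hij a c h
    have h1 : x i * q ^ c = x j := by
      apply mul_right_cancel₀ (pow_ne_zero a hq)
      rw [← h]
      ring
    rcases c with _ | c
    · rw [pow_zero, mul_one] at h1
      rcases lt_or_gt_of_ne hij with h | h
      · exact hx i j h (by rw [h1, div_self (hx0 j), sub_self])
      · exact hx j i h (by rw [h1, div_self (hx0 j), sub_self])
    · apply hxq i j (c + 1)
      rw [qPoch_succ, ← h1]
      have hc : q * (x i / (x i * q ^ (c + 1))) * q ^ c = 1 := by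
        have := hx0 i
        field_simp
        rw [pow_succ']
      rw [hc, sub_self, mul_zero]
  rcases le_total b a with h | h
  · obtain ⟨c, rfl⟩ := Nat.exists_eq_add_of_le h
    exact key i j hij b c
  · obtain ⟨c, rfl⟩ := Nat.exists_eq_add_of_le h
    exact (key j i hij.symm a c).symm

open Polynomial in
theorem sum_prod_div_sub_eq_one {ι : Type*} [Fintype ι] [DecidableEq ι] [Nonempty ι]
    {X : ι → ℂ} (hX : Function.Injective X) :
    ∑ k, ∏ j ∈ Finset.univ.erase k, X k / (X k - X j) = 1 := by
  have hc : 0 < Fintype.card ι := Fintype.card_pos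
  have := Lagrange.coeff_eq_sum (s := Finset.univ) (v := X) hX.injOn
    (P := (Polynomial.X : ℂ[X]) ^ (Fintype.card ι - 1)) (by
      rw [degree_X_pow, Finset.card_univ]
      exact_mod_cast Nat.sub_lt hc one_pos)
  rw [Finset.card_univ, coeff_X_pow_self] at this
  rw [this]
  refine Finset.sum_congr rfl fun k _ => ?_
  rw [Finset.prod_div_distrib, Finset.prod_const, Finset.card_erase_of_mem (Finset.mem_univ k),
    Finset.card_univ]
  simp

open Polynomial in
theorem sum_prod_sub_div_eq {ι : Type*} [Fintype ι] [DecidableEq ι] [Nonempty ι]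
    {x Z : ι → ℂ} (hZ0 : ∀ i, Z i ≠ 0) (hZ : Function.Injective Z) :
    ∑ k, (∏ j, (Z k - x j)) / Z k / ∏ j ∈ Finset.univ.erase k, (Z k - Z j) =
      1 - (∏ j, x j) / ∏ j, Z j := by
  have hc : 0 < Fintype.card ι := Fintype.card_pos
  have hP : ∏ j, Z j ≠ 0 := Finset.prod_ne_zero_iff.2 fun j _ => hZ0 j
  set c := (∏ j, x j) / ∏ j, Z j with hcdef
  set R : ℂ[X] := Lagrange.nodal Finset.univ x - C c * Lagrange.nodal Finset.univ Z with hR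
  have hnod : ∀ v : ι → ℂ, (Lagrange.nodal Finset.univ v).natDegree = Fintype.card ι :=
    fun v => Lagrange.natDegree_nodal
  have hlead : ∀ v : ι → ℂ, (Lagrange.nodal Finset.univ v).coeff (Fintype.card ι) = 1 := by
    intro v
    rw [← hnod v]
    exact Lagrange.nodal_monic
  have hRn : R.coeff (Fintype.card ι) = 1 - c := by
    rw [hR, coeff_sub, coeff_C_mul, hlead, hlead, mul_one]
  have hR0 : R.coeff 0 = 0 := by
    rw [coeff_zero_eq_eval_zero, hR, eval_sub, eval_mul, eval_C, Lagrange.eval_nodal,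
      Lagrange.eval_nodal]
    simp only [zero_sub, Finset.prod_neg, hcdef]
    field_simp
    ring
  have hRdeg : R.natDegree ≤ Fintype.card ι := by
    refine (natDegree_sub_le _ _).trans (max_le (hnod x).le ?_)
    exact (natDegree_C_mul_le _ _).trans (hnod Z).le
  have hdiv : R.divX * Polynomial.X = R := by
    conv_rhs => rw [← divX_mul_X_add R, hR0, C_0, add_zero]
  have heval : ∀ k, R.divX.eval (Z k) = (∏ j, (Z k - x j)) / Z k := by
    intro k
    rw [eq_div_iff (hZ0 k), ← Lagrange.eval_nodal]
    conv_lhs => rw [← eval_X (x := Z k), eval_X, ← eval_mul_X, hdiv, hR]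
    rw [eval_sub, eval_mul, Lagrange.eval_nodal_at_node (Finset.mem_univ k), mul_zero, sub_zero]
  have := Lagrange.coeff_eq_sum (s := Finset.univ) (v := Z) hZ.injOn (P := R.divX) (by
      rw [Finset.card_univ]
      refine lt_of_le_of_lt degree_le_natDegree ?_
      rw [natDegree_divX_eq_natDegree_tsub_one]
      exact_mod_cast (by omega : R.natDegree - 1 < Fintype.card ι))
  rw [Finset.card_univ, coeff_divX, Nat.sub_add_cancel hc, hRn] at this
  rw [this]
  exact Finset.sum_congr rfl fun k _ => by rw [heval]

theorem sum_mul_prod_sub_div_eq {ι : Type*} [Fintype ι] [DecidableEq ι] [Nonempty ι]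
    {x Z : ι → ℂ} (hx0 : ∀ i, x i ≠ 0) (hZ0 : ∀ i, Z i ≠ 0) (hZ : Function.Injective Z) :
    ∑ k, (1 - Z k / x k) *
        ∏ j ∈ Finset.univ.erase k, (Z j / x j * ((Z k - x j) / (Z k - Z j))) =
      1 - ∏ j, Z j / x j := by
  have hP : ∏ j, Z j ≠ 0 := Finset.prod_ne_zero_iff.2 fun j _ => hZ0 j
  have hQ : ∏ j, x j ≠ 0 := Finset.prod_ne_zero_iff.2 fun j _ => hx0 j
  have h := congrArg (fun t => -(∏ j, Z j / x j) * t) (sum_prod_sub_div_eq (x := x) hZ0 hZ)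
  have h' : -(∏ j, Z j / x j) * (1 - (∏ j, x j) / ∏ j, Z j) = 1 - ∏ j, Z j / x j := by
    rw [Finset.prod_div_distrib]
    field_simp
    ring
  rw [← h', ← h, Finset.mul_sum]
  refine Finset.sum_congr rfl fun k _ => ?_
  have hk := hx0 k
  have hk' := hZ0 k
  rw [Finset.prod_mul_distrib, Finset.prod_div_distrib (f := fun j => Z k - x j),
    ← Finset.mul_prod_erase _ (fun j => Z j / x j) (Finset.mem_univ k),
    ← Finset.mul_prod_erase _ (fun j => Z k - x j) (Finset.mem_univ k)]
  field_simp
  ring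

theorem milnePair_add_single {n : ℕ} {q : ℂ} {x : Fin n → ℂ} (hq : q ≠ 0)
    (hx0 : ∀ i, x i ≠ 0) {k j : Fin n} (Y : Fin n → ℕ)
    (hne : x k * q ^ Y k ≠ x j * q ^ Y j) :
    milnePair q (x k / x j) (((Y k + 1 : ℕ) : ℤ) - Y j) =
      milnePair q (x k / x j) ((Y k : ℤ) - Y j) *
        (x k * q ^ Y k / (x j * q ^ Y j) * (q * (x k * q ^ Y k) - x j * q ^ Y j) /
          (x j * q ^ Y j - x k * q ^ Y k)) := by
  have hk := hx0 k
  have hj := hx0 j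
  have hW : x k / x j * q ^ ((Y k : ℤ) - Y j) = x k * q ^ Y k / (x j * q ^ Y j) := by
    rw [zpow_sub₀ hq, zpow_natCast, zpow_natCast]
    field_simp
  have hj' : x j * q ^ Y j ≠ 0 := mul_ne_zero hj (pow_ne_zero _ hq)
  have hd : 1 - x k / x j * q ^ ((Y k : ℤ) - Y j) ≠ 0 := by
    rw [hW, sub_ne_zero, ne_comm]
    exact fun h => hne ((div_eq_one_iff_eq hj').1 h)
  have hd' : x j * q ^ Y j - x k * q ^ Y k ≠ 0 := sub_ne_zero.2 hne.symm
  rw [show ((Y k + 1 : ℕ) : ℤ) - Y j = ((Y k : ℤ) - Y j) + 1 by push_cast; ring,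
    milnePair_add_one hq (div_ne_zero hk hj) _ hd]
  rw [hW] at hd ⊢
  generalize x k * q ^ Y k = a at *
  generalize x j * q ^ Y j = b at *
  congr 1
  have hd3 : 1 - a / b = (b - a) / b := by field_simp
  rw [hd3]
  field_simp
  ring

/-- The telescoping weight: multiplying Milne's coefficients by these weights turns the shift of
one summation index into a Lagrange interpolation weight. -/
noncomputable def milneWeight {n : ℕ} (q : ℂ) (x : Fin n → ℂ) (Y : Fin n → ℕ) (k : Fin n) : ℂ :=
  (1 - x k * q ^ Y k / x k) * ∏ j ∈ Finset.univ.erase k,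
    (x j * q ^ Y j / x j * ((x k * q ^ Y k - x j) / (x k * q ^ Y k - x j * q ^ Y j)))

section Generic

variable {n : ℕ} {q : ℂ} {x : Fin n → ℂ}

theorem milneCoeff_add_single_mul_weight (hq : q ≠ 0) (hx0 : ∀ i, x i ≠ 0)
    (hx : ∀ i j, i < j → 1 - x i / x j ≠ 0)
    (hxq : ∀ i j, ∀ k : ℕ, qPoch (q * (x i / x j)) q k ≠ 0) (Y : Fin n → ℕ) (k : Fin n) :
    milneCoeff q x (Y + Pi.single k 1) * milneWeight q x (Y + Pi.single k 1) k =
      milneCoeff q x Y * ∏ j ∈ Finset.univ.erase k,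
        x k * q ^ Y k / (x k * q ^ Y k - x j * q ^ Y j) := by
  have hne := @mul_pow_ne_mul_pow n q x hq hx0 hx hxq
  generalize hY' : Y + Pi.single k 1 = Y'
  have hYk : Y' k = Y k + 1 := by simp [← hY']
  have hYj : ∀ j, j ≠ k → Y' j = Y j := fun j hj => by simp [← hY', hj]
  have hone : ∀ i j, i ≠ j → 1 - x i / x j ≠ 0 := by
    intro i j hij h
    refine hne hij 0 0 ?_
    rw [sub_eq_zero, eq_comm, div_eq_one_iff_eq (hx0 j)] at h
    rw [h]
  have hsymm : ∀ Y : Fin n → ℕ, ∀ i j, i ≠ j → milnePair q (x i / x j) ((Y i : ℤ) - Y j) =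
      milnePair q (x j / x i) ((Y j : ℤ) - Y i) := by
    intro Y i j hij
    rw [← milnePair_inv_neg hq (div_ne_zero (hx0 j) (hx0 i)) (hone j i hij.symm), inv_div, neg_sub]
  rw [milneCoeff_eq_prod_milnePair hq hx0, milneCoeff_eq_prod_milnePair hq hx0,
    Finset.prod_prod_Ioi_eq_prod_erase_mul _ (hsymm _) k,
    Finset.prod_prod_Ioi_eq_prod_erase_mul _ (hsymm _) k, milneWeight]
  have hrest : ∏ i ∈ Finset.univ.erase k, ∏ j ∈ (Finset.Ioi i).erase k,
        milnePair q (x i / x j)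
          ((Y' i : ℕ) - (Y' j : ℕ) : ℤ) =
      ∏ i ∈ Finset.univ.erase k, ∏ j ∈ (Finset.Ioi i).erase k,
        milnePair q (x i / x j) ((Y i : ℤ) - Y j) := by
    refine Finset.prod_congr rfl fun i hi => Finset.prod_congr rfl fun j hj => ?_
    rw [hYj i (Finset.ne_of_mem_erase hi), hYj j (Finset.ne_of_mem_erase hj)]
  have hpair : ∏ j ∈ Finset.univ.erase k, milnePair q (x k / x j)
          ((Y' k : ℕ) - (Y' j : ℕ) : ℤ) =
      ∏ j ∈ Finset.univ.erase k, (milnePair q (x k / x j) ((Y k : ℤ) - Y j) *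
        (x k * q ^ Y k / (x j * q ^ Y j) * (q * (x k * q ^ Y k) - x j * q ^ Y j) /
          (x j * q ^ Y j - x k * q ^ Y k))) := by
    refine Finset.prod_congr rfl fun j hj => ?_
    have hjk := Finset.ne_of_mem_erase hj
    rw [hYj j hjk, hYk, milnePair_add_single hq hx0 Y (hne hjk.symm _ _)]
  have hden : ∏ i, ∏ j, (qPoch (q * (x i / x j)) q (Y' i))⁻¹ =
      (∏ i, ∏ j, (qPoch (q * (x i / x j)) q (Y i))⁻¹) *
        ∏ j, (1 - q * (x k / x j) * q ^ Y k)⁻¹ := by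
    rw [← Finset.mul_prod_erase _ _ (Finset.mem_univ k), ← Finset.mul_prod_erase _
      (fun i => ∏ j, (qPoch (q * (x i / x j)) q (Y i))⁻¹) (Finset.mem_univ k), hYk]
    have h : ∏ i ∈ Finset.univ.erase k, ∏ j, (qPoch (q * (x i / x j)) q (Y' i))⁻¹ =
        ∏ i ∈ Finset.univ.erase k, ∏ j, (qPoch (q * (x i / x j)) q (Y i))⁻¹ :=
      Finset.prod_congr rfl fun i hi => by rw [hYj i (Finset.ne_of_mem_erase hi)]
    rw [h]
    simp only [qPoch_succ, mul_inv, Finset.prod_mul_distrib]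
    ring
  have hfac : ∀ j, 1 - q * (x k / x j) * q ^ Y k ≠ 0 := by
    intro j h
    apply hxq k j (Y k + 1)
    rw [qPoch_succ, h, mul_zero]
  rw [hrest, hpair, hden, hYk, ← Finset.mul_prod_erase _ (fun j => (1 - q * (x k / x j) *
    q ^ Y k)⁻¹) (Finset.mem_univ k), Finset.prod_mul_distrib]
  have hkk : (1 - q * (x k / x k) * q ^ Y k)⁻¹ * (1 - x k * q ^ (Y k + 1) / x k) = 1 := by
    rw [show x k * q ^ (Y k + 1) / x k = q * (x k / x k) * q ^ Y k by ring,
      inv_mul_cancel₀ (hfac k)]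
  have hprod : (∏ j ∈ Finset.univ.erase k,
        (x k * q ^ Y k / (x j * q ^ Y j) * (q * (x k * q ^ Y k) - x j * q ^ Y j) /
          (x j * q ^ Y j - x k * q ^ Y k))) *
      (∏ j ∈ Finset.univ.erase k, (1 - q * (x k / x j) * q ^ Y k)⁻¹) *
      (∏ j ∈ Finset.univ.erase k, (x j * q ^ Y' j / x j *
        ((x k * q ^ (Y k + 1) - x j) / (x k * q ^ (Y k + 1) - x j * q ^ Y' j)))) =
      ∏ j ∈ Finset.univ.erase k, x k * q ^ Y k / (x k * q ^ Y k - x j * q ^ Y j) := by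
    rw [← Finset.prod_mul_distrib, ← Finset.prod_mul_distrib]
    refine Finset.prod_congr rfl fun j hj => ?_
    have hjk := Finset.ne_of_mem_erase hj
    rw [hYj j hjk]
    have h1 : q * (x k * q ^ Y k) - x j * q ^ Y j ≠ 0 := by
      have := hne hjk.symm (Y k + 1) (Y j)
      rw [sub_ne_zero]
      intro h
      apply this
      rw [← h]
      ring
    have h2 : x j * q ^ Y j - x k * q ^ Y k ≠ 0 := sub_ne_zero.2 (hne hjk _ _)
    have h3 : x k * q ^ Y k - x j * q ^ Y j ≠ 0 := sub_ne_zero.2 (hne hjk.symm _ _)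
    have h5 : x k * q ^ (Y k + 1) = q * (x k * q ^ Y k) := by ring
    have h6 : 1 - q * (x k / x j) * q ^ Y k = (x j - q * (x k * q ^ Y k)) / x j := by
      have := hx0 j
      field_simp
    have h4 : x j - q * (x k * q ^ Y k) ≠ 0 := fun h => hfac j (by rw [h6, h, zero_div])
    have hj0 := hx0 j
    have hqj : q ^ Y j ≠ 0 := pow_ne_zero _ hq
    rw [h5, h6]
    generalize x k * q ^ Y k = a at *
    generalize q ^ Y j = p at *
    rw [show x j * p - a = -(a - x j * p) by ring, show x j - q * a = -(q * a - x j) by ring] at *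
    have h2' : q * a - x j ≠ 0 := neg_ne_zero.1 h4
    rw [mul_comm q a] at *
    field_simp
  rw [← hprod]
  linear_combination (∏ j ∈ Finset.univ.erase k, milnePair q (x k / x j) ((Y k : ℤ) - Y j)) *
    (∏ j ∈ Finset.univ.erase k,
        (x k * q ^ Y k / (x j * q ^ Y j) * (q * (x k * q ^ Y k) - x j * q ^ Y j) /
          (x j * q ^ Y j - x k * q ^ Y k))) *
    (∏ i ∈ Finset.univ.erase k, ∏ j ∈ (Finset.Ioi i).erase k,
        milnePair q (x i / x j) ((Y i : ℤ) - Y j)) *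
    (∏ i, ∏ j, (qPoch (q * (x i / x j)) q (Y i))⁻¹) *
    (∏ j ∈ Finset.univ.erase k, (1 - q * (x k / x j) * q ^ Y k)⁻¹) *
    (∏ j ∈ Finset.univ.erase k, (x j * q ^ Y' j / x j *
        ((x k * q ^ (Y k + 1) - x j) / (x k * q ^ (Y k + 1) - x j * q ^ Y' j)))) *
    hkk

theorem sum_milneWeight [NeZero n] (hq : q ≠ 0) (hx0 : ∀ i, x i ≠ 0)
    (hx : ∀ i j, i < j → 1 - x i / x j ≠ 0)
    (hxq : ∀ i j, ∀ k : ℕ, qPoch (q * (x i / x j)) q k ≠ 0) (Y : Fin n → ℕ) :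
    ∑ k, milneWeight q x Y k = 1 - q ^ ∑ i, Y i := by
  have h := sum_mul_prod_sub_div_eq (Z := fun j => x j * q ^ Y j) hx0
    (fun i => mul_ne_zero (hx0 i) (pow_ne_zero _ hq))
    (fun i j h => by
      by_contra hij
      exact mul_pow_ne_mul_pow hq hx0 hx hxq hij _ _ h)
  simp only [milneWeight]
  rw [h, ← Finset.prod_pow_eq_pow_sum]
  congr 1
  exact Finset.prod_congr rfl fun i _ => mul_div_cancel_left₀ _ (hx0 i)

theorem milneWeight_eq_zero (hx0 : ∀ i, x i ≠ 0) {Y : Fin n → ℕ} {k : Fin n} (h : Y k = 0) :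
    milneWeight q x Y k = 0 := by
  rw [milneWeight, h, pow_zero, mul_one, div_self (hx0 k), sub_self, zero_mul]

theorem sum_piAntidiag_succ_milneCoeff [NeZero n] (hq : q ≠ 0) (hx0 : ∀ i, x i ≠ 0)
    (hx : ∀ i j, i < j → 1 - x i / x j ≠ 0)
    (hxq : ∀ i j, ∀ k : ℕ, qPoch (q * (x i / x j)) q k ≠ 0) (N : ℕ) :
    (1 - q ^ (N + 1)) * ∑ Y ∈ Finset.piAntidiag Finset.univ (N + 1), milneCoeff q x Y =
      ∑ Y ∈ Finset.piAntidiag Finset.univ N, milneCoeff q x Y := by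
  have h1 : (1 - q ^ (N + 1)) * ∑ Y ∈ Finset.piAntidiag Finset.univ (N + 1), milneCoeff q x Y =
      ∑ Y ∈ Finset.piAntidiag Finset.univ (N + 1), ∑ k, milneCoeff q x Y * milneWeight q x Y k := by
    rw [Finset.mul_sum]
    refine Finset.sum_congr rfl fun Y hY => ?_
    rw [← Finset.mul_sum, sum_milneWeight hq hx0 hx hxq, (Finset.mem_piAntidiag.1 hY).1, mul_comm]
  have h2 : ∀ k, ∑ Y ∈ Finset.piAntidiag Finset.univ (N + 1),
        milneCoeff q x Y * milneWeight q x Y k =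
      ∑ Y ∈ Finset.piAntidiag Finset.univ N, milneCoeff q x (Y + Pi.single k 1) *
        milneWeight q x (Y + Pi.single k 1) k := by
    intro k
    symm
    refine Finset.sum_of_injOn (fun Y => Y + Pi.single k 1) (fun a _ b _ h => add_right_cancel h)
      ?_ ?_ fun _ _ => rfl
    · intro Y hY
      have := (Finset.mem_piAntidiag.1 hY).1
      simp [Finset.sum_add_distrib, this]
    · intro Y hY hY'
      rw [milneWeight_eq_zero hx0, mul_zero]
      by_contra hk
      apply hY'
      have hs : Y - Pi.single k 1 + Pi.single k 1 = Y := by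
        ext j
        by_cases hj : j = k
        · subst hj
          simp
          omega
        · simp [hj]
      refine ⟨Y - Pi.single k 1, ?_, hs⟩
      have := (Finset.mem_piAntidiag.1 hY).1
      rw [← hs] at this
      simp only [Pi.add_apply, Finset.sum_add_distrib, Finset.sum_pi_single', Finset.mem_univ,
        if_true] at this
      simpa using this
  have : Nonempty (Fin n) := ⟨0⟩
  rw [h1, Finset.sum_comm, Finset.sum_congr rfl fun k _ => h2 k, Finset.sum_comm]
  refine Finset.sum_congr rfl fun Y _ => ?_
  rw [Finset.sum_congr rfl fun k _ => milneCoeff_add_single_mul_weight hq hx0 hx hxq Y k,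
    ← Finset.mul_sum, sum_prod_div_sub_eq_one (X := fun j => x j * q ^ Y j), mul_one]
  intro i j h
  by_contra hij
  exact mul_pow_ne_mul_pow hq hx0 hx hxq hij _ _ h

/-- Milne's `U(n+1)` identity on the level of homogeneous components. -/
theorem sum_piAntidiag_milneCoeff [NeZero n] (hq : q ≠ 0) (hx0 : ∀ i, x i ≠ 0)
    (hx : ∀ i j, i < j → 1 - x i / x j ≠ 0)
    (hxq : ∀ i j, ∀ k : ℕ, qPoch (q * (x i / x j)) q k ≠ 0) (hqq : ∀ k, qPoch q q k ≠ 0) (N : ℕ) :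
    ∑ Y ∈ Finset.piAntidiag Finset.univ N, milneCoeff q x Y = (qPoch q q N)⁻¹ := by
  induction N with
  | zero =>
    rw [Finset.piAntidiag_zero, Finset.sum_singleton, milneCoeff_eq_prod_milnePair hq hx0]
    have : ∀ i, ∀ j ∈ Finset.Ioi i, milnePair q (x i / x j) 0 = 1 := by
      intro i j hj
      rw [milnePair]
      simp [div_self (hx i j (Finset.mem_Ioi.1 hj))]
    simp only [Pi.zero_apply, qPoch_zero, Nat.cast_zero, sub_zero, inv_one, Finset.prod_const_one,
      mul_one]
    exact Finset.prod_eq_one fun i _ => Finset.prod_eq_one (this i)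
  | succ N ih =>
    have h := sum_piAntidiag_succ_milneCoeff hq hx0 hx hxq N
    have hs : qPoch q q (N + 1) = qPoch q q N * (1 - q ^ (N + 1)) := by
      rw [qPoch_succ, pow_succ']
    have h1 : 1 - q ^ (N + 1) ≠ 0 := fun h0 => hqq (N + 1) (by rw [hs, h0, mul_zero])
    rw [ih] at h
    rw [hs, mul_inv, ← h]
    field_simp

end Generic

section Analysis

open Filter Topology

variable {q : ℂ}

theorem summable_norm_neg_mul_pow (hq1 : ‖q‖ < 1) (a : ℂ) : Summable fun j : ℕ => ‖-(a * q ^ j)‖ := by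
  simp only [norm_neg, norm_mul, norm_pow]
  exact (summable_geometric_of_lt_one (norm_nonneg _) hq1).mul_left _

theorem tendsto_qPoch (hq1 : ‖q‖ < 1) (a : ℂ) :
    Tendsto (qPoch a q) atTop (𝓝 (qPochInf a q)) := by
  have := (multipliable_one_add_of_summable (summable_norm_neg_mul_pow hq1 a)).hasProd.tendsto_prod_nat
  simp only [← sub_eq_add_neg] at this
  exact this

theorem qPochInf_ne_zero (hq1 : ‖q‖ < 1) {a : ℂ} (ha : ∀ k, qPoch a q k ≠ 0) :
    qPochInf a q ≠ 0 := by
  have := tprod_one_add_ne_zero_of_summable (f := fun j : ℕ => -(a * q ^ j)) (fun j h => by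
    apply ha (j + 1)
    rw [qPoch_succ, sub_eq_add_neg, h, mul_zero]) (summable_norm_neg_mul_pow hq1 a)
  simp only [← sub_eq_add_neg] at this
  exact this

theorem exists_norm_le_of_tendsto {f : ℕ → ℂ} {c : ℂ} (h : Tendsto f atTop (𝓝 c)) :
    ∃ K, 0 ≤ K ∧ ∀ k, ‖f k‖ ≤ K := by
  obtain ⟨K, hK⟩ := isBounded_iff_forall_norm_le.1 (Metric.isBounded_range_of_tendsto f h)
  exact ⟨K, (norm_nonneg _).trans (hK (f 0) ⟨0, rfl⟩), fun k => hK _ ⟨k, rfl⟩⟩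

theorem exists_norm_qPoch_le (hq1 : ‖q‖ < 1) (a : ℂ) : ∃ K, 0 ≤ K ∧ ∀ k, ‖qPoch a q k‖ ≤ K :=
  exists_norm_le_of_tendsto (tendsto_qPoch hq1 a)

theorem exists_norm_inv_qPoch_le (hq1 : ‖q‖ < 1) {a : ℂ} (ha : ∀ k, qPoch a q k ≠ 0) :
    ∃ K, 0 ≤ K ∧ ∀ k, ‖(qPoch a q k)⁻¹‖ ≤ K :=
  exists_norm_le_of_tendsto ((tendsto_qPoch hq1 a).inv₀ (qPochInf_ne_zero hq1 ha))

theorem qPoch_ne_zero_of_norm_lt_one (hq1 : ‖q‖ < 1) {a : ℂ} (ha : ‖a‖ < 1) (k : ℕ) :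
    qPoch a q k ≠ 0 := by
  refine Finset.prod_ne_zero_iff.2 fun j _ h => ?_
  have h1 : ‖a * q ^ j‖ < 1 := by
    rw [norm_mul, norm_pow]
    exact (mul_le_of_le_one_right (norm_nonneg _) (pow_le_one₀ (norm_nonneg _) hq1.le)).trans_lt ha
  rw [← sub_eq_zero.1 h, norm_one] at h1
  exact lt_irrefl _ h1

theorem exists_norm_pow_mul_pow_choose_le (hq : q ≠ 0) (hq1 : ‖q‖ < 1) {w : ℂ} (hw : w ≠ 0) :
    ∃ K, 0 ≤ K ∧ ∀ d : ℕ, ‖w ^ d * q ^ d.choose 2‖ ≤ K := by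
  have h0 : ∀ d : ℕ, w ^ d * q ^ d.choose 2 ≠ 0 :=
    fun d => mul_ne_zero (pow_ne_zero _ hw) (pow_ne_zero _ hq)
  have hs : Summable fun d : ℕ => w ^ d * q ^ d.choose 2 := by
    refine summable_of_ratio_test_tendsto_lt_one zero_lt_one (Eventually.of_forall h0) ?_
    have h : ∀ d : ℕ, ‖w ^ (d + 1) * q ^ (d + 1).choose 2‖ / ‖w ^ d * q ^ d.choose 2‖ =
        ‖w‖ * ‖q‖ ^ d := by
      intro d
      rw [div_eq_iff (norm_ne_zero_iff.2 (h0 d)), Nat.choose_succ_succ' d 1, Nat.choose_one_right,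
        ← norm_pow, ← norm_mul, ← norm_mul]
      congr 1
      ring
    simp only [h]
    simpa using (tendsto_pow_atTop_nhds_zero_of_lt_one (norm_nonneg q) hq1).const_mul ‖w‖
  exact exists_norm_le_of_tendsto hs.tendsto_atTop_zero

theorem exists_norm_milnePair_natCast_le (hq : q ≠ 0) (hq1 : ‖q‖ < 1) {w : ℂ} (hw : w ≠ 0) :
    ∃ K, 0 ≤ K ∧ ∀ d : ℕ, ‖milnePair q w d‖ ≤ K := by
  obtain ⟨K, hK0, hK⟩ := exists_norm_pow_mul_pow_choose_le hq hq1 hw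
  refine ⟨(1 + ‖w‖) / ‖1 - w‖ * K, by positivity, fun d => ?_⟩
  have h2 : (d : ℤ) * (d - 1) / 2 = (d.choose 2 : ℕ) :=
    Int.ediv_eq_of_eq_mul_left two_ne_zero (Nat.cast_choose_two_int_mul_two d).symm
  rw [milnePair, h2, zpow_natCast, zpow_natCast, zpow_natCast, zpow_natCast]
  have h3 : ‖1 - w * q ^ d‖ ≤ 1 + ‖w‖ := by
    refine (norm_sub_le _ _).trans ?_
    rw [norm_one, norm_mul, norm_pow]
    gcongr
    exact mul_le_of_le_one_right (norm_nonneg _) (pow_le_one₀ (norm_nonneg _) hq1.le)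
  have h4 : ‖(1 - w * q ^ d) / (1 - w) * w ^ d * (-1) ^ d * q ^ d.choose 2‖ =
      ‖1 - w * q ^ d‖ / ‖1 - w‖ * ‖w ^ d * q ^ d.choose 2‖ := by
    simp only [norm_mul, norm_div, norm_pow, norm_neg, norm_one, one_pow]
    ring
  rw [h4]
  gcongr
  exact hK d

theorem exists_norm_milnePair_le (hq : q ≠ 0) (hq1 : ‖q‖ < 1) {w : ℂ} (hw : w ≠ 0)
    (hw1 : 1 - w ≠ 0) : ∃ K, 0 ≤ K ∧ ∀ d : ℤ, ‖milnePair q w d‖ ≤ K := by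
  obtain ⟨K, hK0, hK⟩ := exists_norm_milnePair_natCast_le hq hq1 hw
  obtain ⟨L, _, hL⟩ := exists_norm_milnePair_natCast_le hq hq1 (inv_ne_zero hw)
  refine ⟨max K L, le_max_of_le_left hK0, fun d => ?_⟩
  rcases Int.eq_nat_or_neg d with ⟨m, rfl | rfl⟩
  · exact (hK m).trans (le_max_left _ _)
  · rw [← milnePair_inv_neg hq hw hw1, neg_neg]
    exact (hL m).trans (le_max_right _ _)

theorem exists_norm_milneCoeff_le {n : ℕ} {x : Fin n → ℂ} (hq : q ≠ 0) (hq1 : ‖q‖ < 1)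
    (hx0 : ∀ i, x i ≠ 0) (hx : ∀ i j, i < j → 1 - x i / x j ≠ 0)
    (hxq : ∀ i j, ∀ k : ℕ, qPoch (q * (x i / x j)) q k ≠ 0) :
    ∃ K, 0 ≤ K ∧ ∀ Y : Fin n → ℕ, ‖milneCoeff q x Y‖ ≤ K := by
  have h1 : ∀ i j, ∃ K : ℝ, 0 ≤ K ∧ (i < j → ∀ d : ℤ, ‖milnePair q (x i / x j) d‖ ≤ K) := by
    intro i j
    by_cases h : i < j
    · obtain ⟨K, hK0, hK⟩ := exists_norm_milnePair_le hq hq1 (div_ne_zero (hx0 i) (hx0 j)) (hx i j h)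
      exact ⟨K, hK0, fun _ => hK⟩
    · exact ⟨0, le_rfl, fun h' => absurd h' h⟩
  choose A hA0 hA using h1
  choose B hB0 hB using fun i j => exists_norm_inv_qPoch_le hq1 (hxq i j)
  refine ⟨(∏ i, ∏ j ∈ Finset.Ioi i, A i j) * ∏ i, ∏ j, B i j,
    mul_nonneg (Finset.prod_nonneg fun i _ => Finset.prod_nonneg fun j _ => hA0 i j)
      (Finset.prod_nonneg fun i _ => Finset.prod_nonneg fun j _ => hB0 i j), fun Y => ?_⟩
  rw [milneCoeff_eq_prod_milnePair hq hx0, norm_mul]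
  simp only [norm_prod]
  refine mul_le_mul ?_ ?_ (by positivity)
    (Finset.prod_nonneg fun i _ => Finset.prod_nonneg fun j _ => hA0 i j)
  · exact Finset.prod_le_prod (fun _ _ => by positivity) fun i _ =>
      Finset.prod_le_prod (fun _ _ => by positivity) fun j hj => hA i j (Finset.mem_Ioi.1 hj) _
  · exact Finset.prod_le_prod (fun _ _ => by positivity) fun i _ =>
      Finset.prod_le_prod (fun _ _ => by positivity) fun j _ => hB i j _

/-- The coefficients of the `q`-binomial series are bounded. -/
theorem exists_norm_qPoch_div_le (hq1 : ‖q‖ < 1) (a : ℂ) :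
    ∃ K, 0 ≤ K ∧ ∀ k, ‖qPoch a q k / qPoch q q k‖ ≤ K := by
  obtain ⟨K, hK0, hK⟩ := exists_norm_qPoch_le hq1 a
  obtain ⟨L, hL0, hL⟩ := exists_norm_inv_qPoch_le hq1 (qPoch_ne_zero_of_norm_lt_one hq1 hq1)
  refine ⟨K * L, by positivity, fun k => ?_⟩
  rw [div_eq_mul_inv, norm_mul]
  exact mul_le_mul (hK k) (hL k) (norm_nonneg _) hK0

theorem summable_mul_pow_of_norm_le {c : ℕ → ℂ} {K : ℝ} (hc : ∀ k, ‖c k‖ ≤ K) {z : ℂ}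
    (hz : ‖z‖ < 1) : Summable fun m => c m * z ^ m := by
  refine Summable.of_norm_bounded (g := fun m => K * ‖z‖ ^ m)
    ((summable_geometric_of_lt_one (norm_nonneg _) hz).mul_left K) fun m => ?_
  rw [norm_mul, norm_pow]
  gcongr
  exact hc m

theorem qBinomial_functional_equation (hq1 : ‖q‖ < 1) (a : ℂ) {z : ℂ} (hz : ‖z‖ < 1) :
    (1 - z) * ∑' m, qPoch a q m / qPoch q q m * z ^ m =
      (1 - a * z) * ∑' m, qPoch a q m / qPoch q q m * (q * z) ^ m := by
  obtain ⟨K, hK0, hK⟩ := exists_norm_qPoch_div_le hq1 a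
  have hqz : ‖q * z‖ < 1 := by
    rw [norm_mul]
    exact mul_lt_one_of_nonneg_of_lt_one_left (norm_nonneg _) hq1 hz.le
  set c : ℕ → ℂ := fun m => qPoch a q m / qPoch q q m with hc
  have h1 : Summable fun m => c m * z ^ m := summable_mul_pow_of_norm_le hK hz
  have h2 : Summable fun m => c m * (q * z) ^ m := summable_mul_pow_of_norm_le hK hqz
  have hrec : ∀ m, c (m + 1) * (1 - q ^ (m + 1)) = c m * (1 - a * q ^ m) := by
    intro m
    have h3 := qPoch_ne_zero_of_norm_lt_one hq1 hq1 (m + 1)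
    have h4 : qPoch q q (m + 1) = qPoch q q m * (1 - q ^ (m + 1)) := by
      rw [qPoch_succ, pow_succ']
    simp only [hc, qPoch_succ a]
    rw [h4] at h3 ⊢
    have h5 := left_ne_zero_of_mul h3
    have h6 := right_ne_zero_of_mul h3
    field_simp
  have hdiff : ∑' m, c m * z ^ m - ∑' m, c m * (q * z) ^ m =
      z * (∑' m, c m * z ^ m - a * ∑' m, c m * (q * z) ^ m) := by
    rw [← h1.tsum_sub h2, (h1.sub h2).tsum_eq_zero_add, ← tsum_mul_left, ← h1.tsum_sub (h2.mul_left a),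
      ← tsum_mul_left]
    simp only [pow_zero, sub_self, zero_add]
    refine tsum_congr fun m => ?_
    rw [mul_pow, mul_pow]
    linear_combination z ^ (m + 1) * hrec m
  linear_combination hdiff

/-- The `q`-binomial theorem. -/
theorem tsum_qPoch_div_mul_pow (hq1 : ‖q‖ < 1) (a : ℂ) {z : ℂ} (hz : ‖z‖ < 1) :
    ∑' m, qPoch a q m / qPoch q q m * z ^ m = qPochInf (a * z) q / qPochInf z q := by
  obtain ⟨K, hK0, hK⟩ := exists_norm_qPoch_div_le hq1 a
  have hne := qPoch_ne_zero_of_norm_lt_one hq1 hz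
  set F : ℂ → ℂ := fun w => ∑' m, qPoch a q m / qPoch q q m * w ^ m with hF
  have hnorm : ∀ N : ℕ, ‖q ^ N * z‖ < 1 := by
    intro N
    rw [norm_mul, norm_pow]
    exact (mul_le_of_le_one_left (norm_nonneg _) (pow_le_one₀ (norm_nonneg _) hq1.le)).trans_lt hz
  have hiter : ∀ N, F z = qPoch (a * z) q N / qPoch z q N * F (q ^ N * z) := by
    intro N
    induction N with
    | zero => simp
    | succ N ih =>
      have h := qBinomial_functional_equation hq1 a (hnorm N)
      have h1 := hne (N + 1)
      rw [qPoch_succ] at h1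
      have h2 := left_ne_zero_of_mul h1
      have h3 := right_ne_zero_of_mul h1
      rw [ih, qPoch_succ, qPoch_succ, pow_succ', mul_assoc q, div_mul_eq_mul_div,
        div_mul_eq_mul_div, div_eq_div_iff h2 h1]
      simp only [hF]
      linear_combination qPoch (a * z) q N * qPoch z q N * h
  have hF0 : Tendsto (fun N : ℕ => F (q ^ N * z)) atTop (𝓝 1) := by
    have hb : ∀ N : ℕ, ‖F (q ^ N * z) - 1‖ ≤ ‖q‖ ^ N * (K * (1 - ‖z‖)⁻¹) := by
      intro N
      have hs := summable_mul_pow_of_norm_le hK (hnorm N)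
      have h1 : F (q ^ N * z) - 1 =
          ∑' m, qPoch a q (m + 1) / qPoch q q (m + 1) * (q ^ N * z) ^ (m + 1) := by
        simp only [hF]
        rw [hs.tsum_eq_zero_add]
        simp
      rw [h1]
      have hg : HasSum (fun m : ℕ => ‖q‖ ^ N * (K * ‖z‖ ^ m)) (‖q‖ ^ N * (K * (1 - ‖z‖)⁻¹)) :=
        ((hasSum_geometric_of_lt_one (norm_nonneg _) hz).mul_left K).mul_left _
      refine tsum_of_norm_bounded hg fun m => ?_
      rw [norm_mul, norm_pow, norm_mul, norm_pow, mul_pow]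
      have h2 : (‖q‖ ^ N) ^ (m + 1) ≤ ‖q‖ ^ N :=
        pow_le_of_le_one (by positivity) (pow_le_one₀ (norm_nonneg _) hq1.le) (by simp)
      have h3 : ‖z‖ ^ (m + 1) ≤ ‖z‖ ^ m :=
        pow_le_pow_of_le_one (norm_nonneg _) hz.le (Nat.le_succ m)
      calc _ ≤ K * (‖q‖ ^ N * ‖z‖ ^ m) := by
            gcongr
            exact hK _
        _ = _ := by ring
    rw [tendsto_iff_norm_sub_tendsto_zero]
    refine squeeze_zero (fun _ => norm_nonneg _) hb ?_
    simpa using (tendsto_pow_atTop_nhds_zero_of_lt_one (norm_nonneg q) hq1).mul_const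
      (K * (1 - ‖z‖)⁻¹)
  have hlim := (((tendsto_qPoch hq1 (a * z)).div (tendsto_qPoch hq1 z)
    (qPochInf_ne_zero hq1 hne)).mul hF0)
  rw [mul_one] at hlim
  refine tendsto_nhds_unique ?_ hlim
  refine tendsto_const_nhds.congr fun N => ?_
  exact hiter N

theorem qPoch_add (a q : ℂ) (k m : ℕ) : qPoch a q (k + m) = qPoch a q k * qPoch (a * q ^ k) q m := by
  rw [qPoch, Finset.prod_range_add, qPoch, qPoch]
  simp only [pow_add, mul_assoc]

theorem qPochInf_eq_mul (hq1 : ‖q‖ < 1) (a : ℂ) (k : ℕ) :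
    qPochInf a q = qPoch a q k * qPochInf (a * q ^ k) q := by
  refine tendsto_nhds_unique ((tendsto_qPoch hq1 a).comp (tendsto_add_atTop_nat k)) ?_
  refine ((tendsto_qPoch hq1 (a * q ^ k)).const_mul (qPoch a q k)).congr fun m => ?_
  rw [Function.comp_apply, add_comm m k, qPoch_add]

theorem exists_norm_convolution_le (hq1 : ‖q‖ < 1) {w : ℕ → ℂ} {K σ : ℝ} {z : ℂ}
    (hzσ : ‖z‖ < σ) (hw : ∀ k, ‖w k‖ ≤ K * σ ^ k) :
    ∃ L, 0 ≤ L ∧ ∀ N, ‖∑ k ∈ Finset.range (N + 1), qBinom q N k * w k * z ^ (N - k)‖ ≤ L * σ ^ N := by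
  have hσ : 0 < σ := (norm_nonneg z).trans_lt hzσ
  have hK0 : 0 ≤ K := by simpa using (norm_nonneg _).trans (hw 0)
  obtain ⟨A, hA0, hA⟩ := exists_norm_qPoch_le hq1 q
  obtain ⟨B, hB0, hB⟩ := exists_norm_inv_qPoch_le hq1 (qPoch_ne_zero_of_norm_lt_one hq1 hq1)
  set ρ := ‖z‖ / σ with hρ
  have hρ0 : 0 ≤ ρ := by positivity
  have hρ1 : ρ < 1 := (div_lt_one hσ).2 hzσ
  have hρ2 : 0 ≤ (1 - ρ)⁻¹ := inv_nonneg.2 (sub_nonneg.2 hρ1.le)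
  refine ⟨A * (B * B) * K * (1 - ρ)⁻¹, by positivity, fun N => ?_⟩
  have hterm : ∀ k ∈ Finset.range (N + 1), ‖qBinom q N k * w k * z ^ (N - k)‖ ≤
      A * (B * B) * K * σ ^ N * ρ ^ (N - k) := by
    intro k hk
    have hkN : k ≤ N := Nat.lt_succ_iff.1 (Finset.mem_range.1 hk)
    have h1 : ‖qBinom q N k‖ ≤ A * (B * B) := by
      rw [qBinom, div_eq_mul_inv, mul_inv, norm_mul, norm_mul]
      exact mul_le_mul (hA _) (mul_le_mul (hB _) (hB _) (norm_nonneg _) hB0) (by positivity) hA0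
    have h2 : ‖z‖ ^ (N - k) = ρ ^ (N - k) * σ ^ (N - k) := by
      rw [← mul_pow, hρ, div_mul_cancel₀ _ hσ.ne']
    have h3 : σ ^ N = σ ^ k * σ ^ (N - k) := by rw [← pow_add, Nat.add_sub_cancel' hkN]
    rw [norm_mul, norm_mul, norm_pow, h2, h3]
    calc _ ≤ A * (B * B) * (K * σ ^ k) * (ρ ^ (N - k) * σ ^ (N - k)) := by
          gcongr
          exact hw k
      _ = _ := by ring
  refine (norm_sum_le_of_le _ hterm).trans ?_
  rw [← Finset.mul_sum]
  have hgeo : ∑ k ∈ Finset.range (N + 1), ρ ^ (N - k) ≤ (1 - ρ)⁻¹ := by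
    have h := Finset.sum_range_reflect (fun k => ρ ^ k) (N + 1)
    simp only [Nat.add_sub_cancel] at h
    rw [h, ← tsum_geometric_of_lt_one hρ0 hρ1]
    exact (summable_geometric_of_lt_one hρ0 hρ1).sum_le_tsum _ fun _ _ => by positivity
  calc _ ≤ A * (B * B) * K * σ ^ N * (1 - ρ)⁻¹ := by gcongr
    _ = _ := by ring

/-- The one-variable generating function behind the multiple series. -/
theorem tsum_convolution_eq (hq1 : ‖q‖ < 1) {w : ℕ → ℂ} {K σ : ℝ} (hσ0 : 0 ≤ σ) (hσ1 : σ < 1)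
    {b z : ℂ} (hz1 : ‖z‖ < 1) (hw : ∀ k, ‖w k‖ ≤ K * σ ^ k) (hbz : ∀ k, qPoch (b * z) q k ≠ 0) :
    Summable (fun k => qPoch b q k / (qPoch (b * z) q k * qPoch q q k) * w k) ∧
    ∑' N, (qPoch q q N)⁻¹ * ((∑ k ∈ Finset.range (N + 1), qBinom q N k * w k * z ^ (N - k)) *
        qPoch b q N) =
      qPochInf (b * z) q / qPochInf z q *
        ∑' k, qPoch b q k / (qPoch (b * z) q k * qPoch q q k) * w k := by
  have hK0 : 0 ≤ K := by simpa using (norm_nonneg _).trans (hw 0)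
  have hqq := qPoch_ne_zero_of_norm_lt_one hq1 hq1
  obtain ⟨A, hA0, hA⟩ := exists_norm_qPoch_le hq1 b
  obtain ⟨B, hB0, hB⟩ := exists_norm_inv_qPoch_le hq1 hqq
  obtain ⟨C, hC0, hC⟩ := exists_norm_inv_qPoch_le hq1 hbz
  have hgσ := summable_geometric_of_lt_one hσ0 hσ1
  have hgz := summable_geometric_of_lt_one (norm_nonneg z) hz1
  refine ⟨?_, ?_⟩
  · refine Summable.of_norm_bounded (g := fun k => A * (C * B) * (K * σ ^ k))
      ((hgσ.mul_left K).mul_left _) fun k => ?_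
    rw [div_eq_mul_inv, mul_inv, norm_mul, norm_mul, norm_mul]
    exact mul_le_mul (mul_le_mul (hA _) (mul_le_mul (hC _) (hB _) (norm_nonneg _) hC0)
      (by positivity) hA0) (hw k) (norm_nonneg _) (by positivity)
  set f : ℕ × ℕ → ℂ := fun p => (qPoch q q p.1)⁻¹ * (qPoch q q p.2)⁻¹ * qPoch b q (p.1 + p.2) *
    w p.1 * z ^ p.2 with hf
  have hfs : Summable f := by
    refine Summable.of_norm_bounded (g := fun p => B * B * A * K * (σ ^ p.1 * ‖z‖ ^ p.2))
      ((hgσ.mul_of_nonneg hgz (fun _ => by positivity) fun _ => by positivity).mul_left _)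
      fun p => ?_
    simp only [hf, norm_mul, norm_pow]
    calc _ ≤ B * B * A * (K * σ ^ p.1) * ‖z‖ ^ p.2 := by
          gcongr
          · exact hB _
          · exact hB _
          · exact hA _
          · exact hw _
      _ = _ := by ring
  have hleft : ∀ N, (qPoch q q N)⁻¹ *
      ((∑ k ∈ Finset.range (N + 1), qBinom q N k * w k * z ^ (N - k)) * qPoch b q N) =
      ∑ p ∈ Finset.HasAntidiagonal.antidiagonal N, f p := by
    intro N
    rw [Finset.Nat.sum_antidiagonal_eq_sum_range_succ_mk, Finset.sum_mul, Finset.mul_sum]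
    refine Finset.sum_congr rfl fun k hk => ?_
    have hkN : k ≤ N := Nat.lt_succ_iff.1 (Finset.mem_range.1 hk)
    simp only [hf, qBinom]
    rw [Nat.add_sub_cancel' hkN]
    have := hqq N
    field_simp
  have hanti : ∑' N, ∑ p ∈ Finset.HasAntidiagonal.antidiagonal N, f p = ∑' p, f p := by
    have h := Finset.HasAntidiagonal.sigmaAntidiagonalEquivProd.summable_iff.2 hfs
    rw [← Finset.HasAntidiagonal.sigmaAntidiagonalEquivProd.tsum_eq f]
    refine Eq.trans ?_ (h.tsum_sigma' fun N => (hasSum_fintype _).summable).symm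
    refine tsum_congr fun N => ?_
    rw [tsum_fintype, ← Finset.sum_coe_sort]
    rfl
  rw [tsum_congr hleft, hanti, hfs.tsum_prod, ← tsum_mul_left]
  refine tsum_congr fun k => ?_
  have h1 : ∀ m, f (k, m) = (qPoch q q k)⁻¹ * qPoch b q k * w k *
      (qPoch (b * q ^ k) q m / qPoch q q m * z ^ m) := by
    intro m
    simp only [hf, qPoch_add]
    ring
  rw [tsum_congr h1, tsum_mul_left, tsum_qPoch_div_mul_pow hq1 _ hz1, qPochInf_eq_mul hq1 (b * z) k]
  have := hbz k
  have := hqq k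
  rw [show b * q ^ k * z = b * z * q ^ k by ring]
  field_simp

theorem summable_pow_sum {n : ℕ} {σ : ℝ} (hσ0 : 0 ≤ σ) (hσ1 : σ < 1) :
    Summable fun Y : Fin n → ℕ => σ ^ ∑ i, Y i := by
  induction n with
  | zero => exact (hasSum_fintype _).summable
  | succ n ih =>
    rw [← (Fin.consEquiv fun _ => ℕ).summable_iff]
    refine ((summable_geometric_of_lt_one hσ0 hσ1).mul_of_nonneg ih (fun _ => by positivity)
      fun _ => by positivity).congr fun p => ?_
    simp [Fin.consEquiv, Fin.sum_univ_succ, pow_add]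

theorem hasSum_mul_of_sum_piAntidiag {n : ℕ} {C : (Fin n → ℕ) → ℂ} {g c : ℕ → ℂ} {K L σ : ℝ}
    (hσ0 : 0 ≤ σ) (hσ1 : σ < 1) (hC : ∀ Y, ‖C Y‖ ≤ K) (hg : ∀ N, ‖g N‖ ≤ L * σ ^ N)
    (hsum : ∀ N, ∑ Y ∈ Finset.piAntidiag Finset.univ N, C Y = c N) :
    HasSum (fun Y => C Y * g (∑ i, Y i)) (∑' N, c N * g N) := by
  have hK0 : 0 ≤ K := (norm_nonneg _).trans (hC 0)
  have hs : Summable fun Y : Fin n → ℕ => C Y * g (∑ i, Y i) := by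
    refine Summable.of_norm_bounded (g := fun Y => K * (L * σ ^ ∑ i, Y i))
      (((summable_pow_sum hσ0 hσ1).mul_left L).mul_left K) fun Y => ?_
    rw [norm_mul]
    exact mul_le_mul (hC Y) (hg _) (norm_nonneg _) hK0
  have h := hs.hasSum.tsum_fiberwise fun Y => ∑ i, Y i
  have hfib : ∀ N, ∑' Y : ((fun Y : Fin n → ℕ => ∑ i, Y i) ⁻¹' {N}), C Y * g (∑ i, Y.1 i) =
      c N * g N := by
    intro N
    have hset : (fun Y : Fin n → ℕ => ∑ i, Y i) ⁻¹' {N} =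
        ((Finset.piAntidiag Finset.univ N : Finset (Fin n → ℕ)) : Set (Fin n → ℕ)) := by
      ext Y
      simp
    rw [hset, Finset.tsum_subtype' _ (fun Y : Fin n → ℕ => C Y * g (∑ i, Y i)), ← hsum,
      Finset.sum_mul]
    exact Finset.sum_congr rfl fun Y hY => by rw [(Finset.mem_piAntidiag.1 hY).1]
  simp only [hfib] at h
  rw [h.tsum_eq]
  exact hs.hasSum

end Analysis

theorem norm_lt_one_of_forall_lt {n : ℕ} [NeZero n] {q z : ℂ} (hq0 : 0 < ‖q‖) (hq1 : ‖q‖ < 1)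
    {x : Fin n → ℂ} (hx0 : ∀ i, x i ≠ 0)
    (hz : ∀ m : Fin n,
      ‖z‖ < ‖∏ i, x i‖ * ‖x m‖ ^ (-(n : ℤ)) * ‖q‖ ^ (((n : ℝ) - 1) / 2)) : ‖z‖ < 1 := by
  by_contra! h
  have h1 := Finset.prod_lt_prod_of_nonempty (s := Finset.univ) (f := fun _ : Fin n => ‖z‖)
    (fun _ _ => zero_lt_one.trans_le h) (fun m _ => hz m) ⟨0, Finset.mem_univ _⟩
  have hP : ∏ i, ‖x i‖ ≠ 0 := Finset.prod_ne_zero_iff.2 fun i _ => norm_ne_zero_iff.2 (hx0 i)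
  have h2 : ∏ m, (‖∏ i, x i‖ * ‖x m‖ ^ (-(n : ℤ)) * ‖q‖ ^ (((n : ℝ) - 1) / 2)) =
      (‖q‖ ^ (((n : ℝ) - 1) / 2)) ^ n := by
    rw [Finset.prod_mul_distrib, Finset.prod_mul_distrib, Finset.prod_zpow, norm_prod]
    simp only [Finset.prod_const, Finset.card_univ, Fintype.card_fin, zpow_neg, zpow_natCast]
    rw [mul_inv_cancel₀ (pow_ne_zero _ hP), one_mul]
  have hn : (1 : ℝ) ≤ n := by exact_mod_cast NeZero.one_le
  have h3 : (‖q‖ ^ (((n : ℝ) - 1) / 2)) ^ n ≤ 1 :=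
    pow_le_one₀ (by positivity) (Real.rpow_le_one hq0.le hq1.le (by linarith))
  have h4 : 1 ≤ ∏ _m : Fin n, ‖z‖ := by
    rw [Finset.prod_const]
    exact one_le_pow₀ h
  rw [h2] at h1
  linarith

theorem qPoch_eq_zero_of_le {a q : ℂ} {m k : ℕ} (h : qPoch a q m = 0) (hmk : m ≤ k) :
    qPoch a q k = 0 := by
  obtain ⟨d, rfl⟩ := Nat.exists_eq_add_of_le hmk
  rw [qPoch_add, h, zero_mul]

/-- Where the factor `c` does not vanish, the sequence `W` may be replaced by a geometrically
bounded one. -/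
theorem exists_geometric_majorant {W c : ℕ → ℂ} {y : ℂ} {ρ M : ℝ} (hρ0 : 0 ≤ ρ) (hρ1 : ρ < 1)
    (hW : ∀ k, ‖W k‖ ≤ M) (h : ‖y‖ < 1 ∨ ∃ m, ∀ k, m ≤ k → W k * c k = 0) :
    ∃ (w : ℕ → ℂ) (K σ : ℝ), ρ < σ ∧ σ < 1 ∧ (∀ k, ‖w k‖ ≤ K * σ ^ k) ∧
      ∀ k, w k * c k = W k * y ^ k * c k := by
  have hM : 0 ≤ M := (norm_nonneg _).trans (hW 0)
  rcases h with hy | ⟨m, hm⟩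
  · obtain ⟨σ, h1, h2⟩ := exists_between (max_lt hρ1 hy)
    refine ⟨fun k => W k * y ^ k, M, σ, (le_max_left _ _).trans_lt h1, h2, fun k => ?_,
      fun _ => rfl⟩
    rw [norm_mul, norm_pow]
    have := ((le_max_right _ _).trans_lt h1).le
    gcongr
    exact hW k
  · obtain ⟨σ, h1, h2⟩ := exists_between hρ1
    have hσ := hρ0.trans_lt h1
    refine ⟨fun k => if k < m then W k * y ^ k else 0,
      ∑ k ∈ Finset.range m, ‖W k * y ^ k‖ / σ ^ k, σ, h1, h2, fun k => ?_, fun k => ?_⟩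
    · dsimp only
      split_ifs with hk
      · rw [← div_le_iff₀ (by positivity)]
        exact Finset.single_le_sum (f := fun k => ‖W k * y ^ k‖ / σ ^ k)
          (fun _ _ => by positivity) (Finset.mem_range.2 hk)
      · rw [norm_zero]
        exact mul_nonneg (Finset.sum_nonneg fun _ _ => by positivity) (by positivity)
    · dsimp only
      split_ifs with hk
      · rfl
      · rw [zero_mul, mul_right_comm, hm k (not_lt.1 hk), zero_mul]

theorem theorem8 (n : ℕ) (hn : 1 ≤ n) (q : ℂ) (hq0 : 0 < ‖q‖) (hq1 : ‖q‖ < 1)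
    (x : Fin n → ℂ) (r s t u v b z y : ℂ)
    -- none of the denominators vanishes
    (hx0 : ∀ i, x i ≠ 0)
    (hx : ∀ i j, i < j → 1 - x i / x j ≠ 0)
    (hxq : ∀ i j, ∀ k : ℕ, qPoch (q * (x i / x j)) q k ≠ 0)
    (hu : ∀ k : ℕ, qPoch u q k ≠ 0)
    (hv : ∀ k : ℕ, qPoch v q k ≠ 0)
    (hbz : ∀ k : ℕ, qPoch (b * z) q k ≠ 0)
    -- convergence condition on `z`
    (hz : ∀ m : Fin n,
      ‖z‖ < ‖∏ i, x i‖ * ‖x m‖ ^ (-(n : ℤ)) * ‖q‖ ^ (((n : ℝ) - 1) / 2))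
    -- the series `₄φ₃` on the right has argument in the unit disc, or it terminates
    (hy : ‖y‖ < 1 ∨ ∃ m : ℕ, qPoch r q m = 0 ∨ qPoch s q m = 0 ∨ qPoch t q m = 0 ∨
      qPoch b q m = 0) :
    Summable (basicHypTerm [r, s, t, b] [u, v, b * z] q y) ∧
    HasSum
      (fun Y : Fin n → ℕ =>
        milneCoeff q x Y * alSalamCarlitzPhi r s t u v q (∑ i, Y i) z y
          * qPoch b q (∑ i, Y i))
      (qPochInf (b * z) q / qPochInf z q * basicHyp [r, s, t, b] [u, v, b * z] q y) := by
  have : NeZero n := ⟨Nat.one_le_iff_ne_zero.1 hn⟩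
  have hq : q ≠ 0 := norm_pos_iff.1 hq0
  have hqq := qPoch_ne_zero_of_norm_lt_one hq1 hq1
  have hz1 := norm_lt_one_of_forall_lt hq0 hq1 hx0 hz
  set W : ℕ → ℂ := fun k => (qPoch r q k * qPoch s q k * qPoch t q k) / (qPoch u q k * qPoch v q k)
    with hWdef
  obtain ⟨M, hM⟩ : ∃ M, ∀ k, ‖W k‖ ≤ M := by
    obtain ⟨M, -, hM⟩ := exists_norm_le_of_tendsto
      ((((tendsto_qPoch hq1 r).mul (tendsto_qPoch hq1 s)).mul (tendsto_qPoch hq1 t)).div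
        ((tendsto_qPoch hq1 u).mul (tendsto_qPoch hq1 v))
        (mul_ne_zero (qPochInf_ne_zero hq1 hu) (qPochInf_ne_zero hq1 hv)))
    exact ⟨M, hM⟩
  have hterm : ‖y‖ < 1 ∨ ∃ m, ∀ k, m ≤ k → W k * qPoch b q k = 0 := by
    refine hy.imp_right fun ⟨m, hm⟩ => ⟨m, fun k hk => ?_⟩
    rcases hm with h | h | h | h <;> simp [hWdef, qPoch_eq_zero_of_le h hk]
  obtain ⟨w, K, σ, hzσ, hσ1, hw, hwW⟩ :=
    exists_geometric_majorant (norm_nonneg z) hz1 hM hterm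
  have hσ0 : 0 ≤ σ := (norm_nonneg z).trans hzσ.le
  obtain ⟨hsum, htsum⟩ := tsum_convolution_eq hq1 hσ0 hσ1 hz1 hw hbz
  have hbasic : basicHypTerm [r, s, t, b] [u, v, b * z] q y =
      fun k => qPoch b q k / (qPoch (b * z) q k * qPoch q q k) * w k := by
    funext k
    have h1 : qPoch b q k / (qPoch (b * z) q k * qPoch q q k) * w k =
        w k * qPoch b q k / (qPoch (b * z) q k * qPoch q q k) := by ring
    rw [h1, hwW, basicHypTerm]
    have h2 : (1 + ((([u, v, b * z] : List ℂ).length : ℕ) : ℤ) -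
        ((([r, s, t, b] : List ℂ).length : ℕ) : ℤ)) = 0 := by simp
    rw [h2, zpow_zero]
    simp only [List.map_cons, List.map_nil, List.prod_cons, List.prod_nil, mul_one, one_mul, hWdef]
    have := hu k
    have := hv k
    have := hbz k
    have := hqq k
    field_simp
  have hphi : ∀ N, alSalamCarlitzPhi r s t u v q N z y * qPoch b q N =
      (∑ k ∈ Finset.range (N + 1), qBinom q N k * w k * z ^ (N - k)) * qPoch b q N := by
    intro N
    rw [alSalamCarlitzPhi, Finset.sum_mul, Finset.sum_mul]
    refine Finset.sum_congr rfl fun k hk => ?_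
    obtain ⟨d, rfl⟩ := Nat.exists_eq_add_of_le (Nat.lt_succ_iff.1 (Finset.mem_range.1 hk))
    rw [qPoch_add b]
    linear_combination (-qBinom q (k + d) k * z ^ (k + d - k) * qPoch (b * q ^ k) q d) * hwW k
  obtain ⟨C, hC0, hC⟩ := exists_norm_milneCoeff_le hq hq1 hx0 hx hxq
  obtain ⟨L, hL0, hL⟩ := exists_norm_convolution_le hq1 hzσ hw
  obtain ⟨B, hB0, hB⟩ := exists_norm_qPoch_le hq1 b
  refine ⟨hbasic ▸ hsum, ?_⟩
  have hmain := hasSum_mul_of_sum_piAntidiag (C := milneCoeff q x) (L := L * B)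
    (g := fun N => (∑ k ∈ Finset.range (N + 1), qBinom q N k * w k * z ^ (N - k)) * qPoch b q N)
    hσ0 hσ1 hC (fun N => by
      rw [norm_mul]
      calc _ ≤ L * σ ^ N * B := mul_le_mul (hL N) (hB N) (norm_nonneg _) (by positivity)
        _ = _ := by ring)
    (sum_piAntidiag_milneCoeff hq hx0 hx hxq hqq)
  rw [htsum] at hmain
  simp only [basicHyp, hbasic]
  convert hmain using 2 with Y
  rw [mul_assoc, hphi]
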